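/- Let $n\ge 1$ and let $A\in\mathbb{R}^{n\times n}$ be stable, i.e. all its complex eigenvalues have negative real part. For $i=1,\dots,n$ let $W_i:=\int_0^\infty e^{At}e_ie_i^\top e^{A^\top t}\,\mathrm{d}t$, where $e_i$ is the $i$-th standard vector, and for $p\in\mathbb{R}^n$ put $W(p):=\sum_{i=1}^n p_iW_i$. Let $X:=\{p\in\mathbb{R}^n : W(p)\succ O\}$ (an open set), $f(p):=-\log\det W(p)$ for $p\in X$, $\Delta:=\{p\in\mathbb{R}^n : \sum_{i=1}^n p_i=1,\ p_i\ge 0 \ (i=1,\dots,n)\}$ and $\mathcal{F}:=X\cap\Delta$. The volumetric controllability score (VCS) is the minimizer of $f$ over $\mathcal{F}$. For a nonempty closed convex set $C\subset\mathbb{R}^n$ let $\Pi_C$ be the Euclidean projection onto $C$. Fix $\sigma,\rho\in(0,1)$ and $\alpha>0$. Consider the following method, started at $p^{(0)}:=(1/n,\dots,1/n)$. In iteration $k=0,1,\dots$, the step size $\alpha^{(k)}$ is the first number $a$ in the sequence $\alpha,\rho\alpha,\rho^2\alpha,\dots$ such that $\tilde p:=\Pi_\Delta\bigl(p^{(k)}-a\nabla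 f(p^{(k)})\bigr)$ satisfies $\tilde p\in X$ and $f(\tilde p)\le f(p^{(k)})+\sigma\nabla f(p^{(k)})^\top(\tilde p-p^{(k)})$; then $p^{(k+1)}:=\Pi_\Delta\bigl(p^{(k)}-\alpha^{(k)}\nabla f(p^{(k)})\bigr)$, and the method stops and returns $p^{(k+1)}$ if $p^{(k+1)}=p^{(k)}$ (in which case we put $p^{(l)}:=p^{(k+1)}$ for all $l>k+1$). Let $\mathcal{F}_0:=\{p\in\mathcal{F} : f(p)\le f(p^{(0)})\}$. Then $p^{(0)}\in\mathcal{F}$, the set $\mathcal{F}_0$ is compact and convex, $f$ is convex on $\mathcal{F}_0$, and the method is well defined (each search for a step size ends after finitely many trials). There is a unique VCS $p^*$, and $p^*$ is also the unique minimizer of $f$ over $\mathcal{F}_0$. The generated sequence satisfies $$\lim_{k\to\infty}p^{(k)}=p^*,$$ and if the method stops, the point it returns is $p^*$. Moreover, $p^{(k)}\in\mathcal{F}_0$ for all $k$, and $p^{(k+1)}=\Pi_{\mathcal{F}_0}\bigl(p^{(k)}-\alpha^{(k)}\nabla f(p^{(k)})\bigr)$ in every iteration $k$ that is carried out, so the method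 is a projected gradient method for the convex problem of minimizing $f$ over $\mathcal{F}_0$. -/

import Mathlib

open Filter Topology

namespace ControllabilityScore

noncomputable section

/-- `ℝⁿ` with the Euclidean norm. -/
abbrev Vec (n : ℕ) : Type := EuclideanSpace ℝ (Fin n)

/-- `A` is stable (Hurwitz): every complex eigenvalue has negative real part. -/
def IsStable {n : ℕ} (A : Matrix (Fin n) (Fin n) ℝ) : Prop :=
  ∀ μ : ℂ, Module.End.HasEigenvalue
    (Matrix.toLin' (A.map (fun x : ℝ => (x : ℂ)))) μ → μ.re < 0

/-- The controllability Gramian `W i = ∫₀^∞ exp (t A) eᵢ eᵢᵀ exp (t Aᵀ) dt`, integrated entrywise. -/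
def gramian {n : ℕ} (A : Matrix (Fin n) (Fin n) ℝ) (i : Fin n) : Matrix (Fin n) (Fin n) ℝ :=
  Matrix.of fun a b => ∫ t in Set.Ioi (0 : ℝ),
    (NormedSpace.exp (t • A)
      * Matrix.vecMulVec (Pi.single i (1 : ℝ)) (Pi.single i (1 : ℝ))
      * NormedSpace.exp (t • A.transpose)) a b

/-- `W_con p = ∑ i, p i • W i`. -/
def Wcon {n : ℕ} (A : Matrix (Fin n) (Fin n) ℝ) (p : Vec n) : Matrix (Fin n) (Fin n) ℝ :=
  ∑ i, p i • gramian A i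

/-- The set `X` of all `p` with `W_con p` positive definite. -/
def posDefSet {n : ℕ} (A : Matrix (Fin n) (Fin n) ℝ) : Set (Vec n) :=
  {p | (Wcon A p).PosDef}

/-- The standard simplex `Δ` in `ℝⁿ`. -/
def simplex (n : ℕ) : Set (Vec n) :=
  {p | ∑ i, p i = 1 ∧ ∀ i, 0 ≤ p i}

/-- The objective `f p = - log det (W_con p)`. It is meaningful on the open set `X` only;
every use of a value `f p` below comes together with `p ∈ X`. -/
def objective {n : ℕ} (A : Matrix (Fin n) (Fin n) ℝ) (p : Vec n) : ℝ :=
  - Real.log (Wcon A p).det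

/-- The feasible set `F = X ∩ Δ`. -/
def feasible {n : ℕ} (A : Matrix (Fin n) (Fin n) ℝ) : Set (Vec n) :=
  posDefSet A ∩ simplex n

/-- The sublevel set `F₀ = {p | f p ≤ f p₀} ∩ F`. -/
def sublevel {n : ℕ} (A : Matrix (Fin n) (Fin n) ℝ) (p₀ : Vec n) : Set (Vec n) :=
  {p | objective A p ≤ objective A p₀} ∩ feasible A

/-- `p` solves the problem of minimizing `f` over `S`. -/
def IsSolution {n : ℕ} (f : Vec n → ℝ) (S : Set (Vec n)) (p : Vec n) : Prop :=
  p ∈ S ∧ IsMinOn f S p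

/-- `p` is an optimal solution of the controllability scoring problem: minimize `f` over `F`. -/
def IsVCS {n : ℕ} (A : Matrix (Fin n) (Fin n) ℝ) (p : Vec n) : Prop :=
  IsSolution (objective A) (feasible A) p

/-- The projection onto `C`: a point of `C` minimizing the distance to `q`
(`argmin` of `‖p - q‖ ^ 2` over `p ∈ C`; see `proj_spec` and `proj_eq` below). -/
def proj {n : ℕ} (C : Set (Vec n)) (q : Vec n) : Vec n :=
  Classical.epsilon fun p => IsSolution (fun r => ‖r - q‖ ^ 2) C p

theorem proj_spec {n : ℕ} {C : Set (Vec n)} (hne : C.Nonempty) (hC : IsClosed C) (q : Vec n) :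
    IsSolution (fun r => ‖r - q‖ ^ 2) C (proj C q) := by
  refine Classical.epsilon_spec (p := fun p => IsSolution (fun r => ‖r - q‖ ^ 2) C p) ?_
  obtain ⟨p, hp, h⟩ := hC.exists_infDist_eq_dist hne q
  refine ⟨p, hp, fun r hr => ?_⟩
  have h1 := Metric.infDist_le_dist_of_mem (x := q) hr
  rw [h, dist_comm q p, dist_comm q r, dist_eq_norm, dist_eq_norm] at h1
  exact pow_le_pow_left₀ (norm_nonneg _) h1 2

theorem proj_eq {n : ℕ} {C : Set (Vec n)} (hC : Convex ℝ C) {q p : Vec n}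
    (hp : IsSolution (fun r => ‖r - q‖ ^ 2) C p) : proj C q = p := by
  obtain ⟨h1, h2⟩ : IsSolution (fun r => ‖r - q‖ ^ 2) C (proj C q) :=
    Classical.epsilon_spec (p := fun p => IsSolution (fun r => ‖r - q‖ ^ 2) C p) ⟨p, hp⟩
  set u := proj C q
  have hm : (1 / 2 : ℝ) • u + (1 / 2 : ℝ) • p ∈ C :=
    hC h1 hp.1 (by norm_num) (by norm_num) (by norm_num)
  have e1 : ‖u - q‖ ^ 2 ≤ ‖(1 / 2 : ℝ) • u + (1 / 2 : ℝ) • p - q‖ ^ 2 := h2 hm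
  have e2 : ‖p - q‖ ^ 2 ≤ ‖(1 / 2 : ℝ) • u + (1 / 2 : ℝ) • p - q‖ ^ 2 := hp.2 hm
  have hq : (1 / 2 : ℝ) • u + (1 / 2 : ℝ) • p - q = (1 / 2 : ℝ) • ((u - q) + (p - q)) := by
    module
  have par := parallelogram_law_with_norm ℝ (u - q) (p - q)
  rw [hq, norm_smul, mul_pow] at e1 e2
  rw [show (u - q) - (p - q) = u - p by abel] at par
  norm_num at e1 e2
  have h0 : ‖u - p‖ = 0 := by nlinarith [norm_nonneg (u - p)]
  exact sub_eq_zero.mp (norm_eq_zero.mp h0)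

/-- The trial point `Π_Δ (p - a ∇f(p))` for the step size `a`. -/
def trial {n : ℕ} (A : Matrix (Fin n) (Fin n) ℝ) (p : Vec n) (a : ℝ) : Vec n :=
  proj (simplex n) (p - a • gradient (objective A) p)

/-- The test in the Armijo rule along the projection arc at `p` for the step size `a`.
A trial point outside `X`, where `f` is not defined (so `f = +∞`), does not pass. -/
def ArmijoTest {n : ℕ} (A : Matrix (Fin n) (Fin n) ℝ) (σ : ℝ) (p : Vec n) (a : ℝ) : Prop :=
  trial A p a ∈ posDefSet A ∧
    objective A (trial A p a) ≤
      objective A p + σ * inner ℝ (gradient (objective A) p) (trial A p a - p)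

/-- `a` is the output of the backtracking loop at `p`, started at `α`: the first of
`α, ρ α, ρ² α, …` that passes the test. -/
def IsArmijoStep {n : ℕ} (A : Matrix (Fin n) (Fin n) ℝ) (σ ρ α : ℝ) (p : Vec n) (a : ℝ) : Prop :=
  ∃ m : ℕ, a = ρ ^ m * α ∧ ArmijoTest A σ p a ∧ ∀ j < m, ¬ ArmijoTest A σ p (ρ ^ j * α)

/-- The starting point `(1/n, …, 1/n)`. -/
def uniform (n : ℕ) : Vec n := WithLp.toLp 2 fun _ => (n : ℝ)⁻¹

/-- The method has returned before iteration `k`, i.e. the stopping test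
`‖p j - p (j + 1)‖ ≤ ε` has held in some iteration `j < k`. -/
def Stopped {n : ℕ} (ε : ℝ) (p : ℕ → Vec n) (k : ℕ) : Prop :=
  ∃ j < k, ‖p j - p (j + 1)‖ ≤ ε

/-- `p` is the sequence of iterates, and `a` the sequence of step sizes, of a run of the projected
gradient method with parameters `σ, ρ, α` and tolerance `ε`. If the method returns,
the sequence stays at the returned point from then on (the values of `a` after that are unused). -/
structure IsRun {n : ℕ} (A : Matrix (Fin n) (Fin n) ℝ) (σ ρ α ε : ℝ)
    (p : ℕ → Vec n) (a : ℕ → ℝ) : Prop where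
  init : p 0 = uniform n
  armijo : ∀ k, ¬ Stopped ε p k → IsArmijoStep A σ ρ α (p k) (a k)
  step : ∀ k, ¬ Stopped ε p k →
    p (k + 1) = proj (simplex n) (p k - a k • gradient (objective A) (p k))
  hold : ∀ k, Stopped ε p k → p (k + 1) = p k

end

end ControllabilityScore

open ControllabilityScore

/-!
Write `E(t) = exp (t A)`. A stable `A` has `‖E(t)‖ ≤ C exp (-c t)` with `c > 0`: the eigenvalues of
`exp A` are exponentials of eigenvalues of `A`, so the spectral radius of `exp A` is below one and
Gelfand's formula gives a power of `exp A` of norm below one (`exists_abs_exp_entry_le`). Hence the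
integrals that define the Gramians converge, and integrating `d/dt (E(t) eᵢ eᵢᵀ E(t)ᵀ)` yields the
Lyapunov equation `A W(p) + W(p) Aᵀ = -diag p` (`lyapunov_Wcon`). It has two consequences: `W` is
injective, and `W(p)` is positive definite when all `pᵢ` are positive, so that the uniform starting
point is feasible.

By simultaneous diagonalization `log det` is strictly concave on positive definite matrices
(`log_det_strictConcave`); since `W` is linear and injective, `f` is strictly convex on `X`. On the
simplex `W(p)` is positive semidefinite, so a lower bound on `det W(p)` cuts out the sublevel set
`F₀`, which is therefore compact. Existence and uniqueness of the minimizer follow.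

For the method, `∇f` is locally Lipschitz on `X`, and compactness of `F₀` turns the local second
order bound into a threshold `b > 0` below which every step size passes the Armijo test at every
point of `F₀` (`exists_forall_armijoTest`). So each search ends, the iterates stay in `F₀`, and the
step sizes stay in `[min α (ρ b), α]`. The variational inequality of the projection then bounds the
gap `δₖ = f(pₖ) - f(p*)` by `C ‖pₖ - pₖ₊₁‖`, while the Armijo condition gives
`δₖ - δₖ₊₁ ≥ (σ / α) ‖pₖ - pₖ₊₁‖²`. Together `δₖ² ≤ C' (δₖ - δₖ₊₁)`, which forces `δₖ → 0`
(`IsRun.tendsto_objective`); compactness of `F₀` and uniqueness of the minimizer give `pₖ → p*`.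
The projection onto the simplex lies in `F₀`, so it is also the projection onto `F₀`.
-/

namespace ControllabilityScore

/-! ### Exponential decay of `exp (t A)` for stable `A` -/

section Decay

open scoped Matrix.Norms.Operator

variable {n : ℕ}

theorem exp_mulVec_of_eigenvector {B : Matrix (Fin n) (Fin n) ℂ} {v : Fin n → ℂ} {μ : ℂ}
    (h : B.mulVec v = μ • v) : (NormedSpace.exp B).mulVec v = Complex.exp μ • v := by
  have hpow : ∀ k : ℕ, (B ^ k).mulVec v = μ ^ k • v := by
    intro k
    induction k with
    | zero => simp
    | succ k ih =>
      rw [pow_succ, ← Matrix.mulVec_mulVec, h, Matrix.mulVec_smul, ih, smul_smul, pow_succ, mul_comm]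
  have h1 := NormedSpace.exp_series_hasSum_exp' (𝕂 := ℂ) B
  let φ : Matrix (Fin n) (Fin n) ℂ →+ (Fin n → ℂ) :=
    { toFun := fun M => M.mulVec v
      map_zero' := Matrix.zero_mulVec v
      map_add' := fun M N => Matrix.add_mulVec M N v }
  have h2 := h1.map φ (Continuous.matrix_mulVec continuous_id continuous_const)
  have h3 := (NormedSpace.exp_series_hasSum_exp' (𝕂 := ℂ) μ).smul_const v
  rw [← Complex.exp_eq_exp_ℂ] at h3
  refine h2.unique ?_
  convert! h3 using 2 with k
  simp [φ, Matrix.smul_mulVec, hpow, smul_smul]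

/-- Every eigenvalue `z` of `exp B` is `exp μ` for an eigenvalue `μ` of `B`: the eigenspace of
`exp B` for `z` is invariant under `B`, hence contains an eigenvector of `B`. -/
theorem exists_eigenvalue_of_mem_spectrum_exp {B : Matrix (Fin n) (Fin n) ℂ} {z : ℂ}
    (hz : z ∈ spectrum ℂ (NormedSpace.exp B)) :
    ∃ μ : ℂ, Module.End.HasEigenvalue (Matrix.toLin' B) μ ∧ z = Complex.exp μ := by
  rw [← Matrix.spectrum_toLin', ← Module.End.hasEigenvalue_iff_mem_spectrum] at hz
  set T : Module.End ℂ (Fin n → ℂ) := Matrix.toLin' (NormedSpace.exp B)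
  have hcomm : Commute T (Matrix.toLin' B) := by
    have hc : Commute (NormedSpace.exp B) B := (Commute.refl B).exp_left
    change T * Matrix.toLin' B = Matrix.toLin' B * T
    simp only [T, Module.End.mul_eq_comp, ← Matrix.toLin'_mul, hc.eq]
  have hmaps : ∀ x ∈ T.eigenspace z, Matrix.toLin' B x ∈ T.eigenspace z :=
    Module.End.mapsTo_genEigenspace_of_comm hcomm z 1
  have : Nontrivial (T.eigenspace z) :=
    Submodule.nontrivial_iff_ne_bot.mpr (Module.End.hasEigenvalue_iff.mp hz)
  obtain ⟨μ, hμ⟩ := Module.End.exists_eigenvalue ((Matrix.toLin' B).restrict hmaps)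
  obtain ⟨⟨v, hv⟩, hv2⟩ := hμ.exists_hasEigenvector
  have hv0 : v ≠ 0 := fun h => hv2.2 (by ext1; exact h)
  have hBv : (Matrix.toLin' B) v = μ • v := congrArg Subtype.val hv2.apply_eq_smul
  refine ⟨μ, Module.End.hasEigenvalue_of_hasEigenvector
    (Module.End.hasEigenvector_iff.mpr ⟨Module.End.mem_eigenspace_iff.mpr hBv, hv0⟩), ?_⟩
  have h1 : T v = z • v := Module.End.mem_eigenspace_iff.mp hv
  have h2 : T v = Complex.exp μ • v := by
    simpa [T] using exp_mulVec_of_eigenvector (by simpa using hBv)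
  exact smul_left_injective ℂ hv0 (h1.symm.trans h2)

/-- Gelfand's formula for `exp B`, whose spectral radius is below one by
`exists_eigenvalue_of_mem_spectrum_exp`. -/
theorem exists_norm_exp_nsmul_lt_one {B : Matrix (Fin n) (Fin n) ℂ}
    (hB : ∀ μ : ℂ, Module.End.HasEigenvalue (Matrix.toLin' B) μ → μ.re < 0) :
    ∃ N : ℕ, 0 < N ∧ ‖NormedSpace.exp ((N : ℝ) • B)‖ < 1 := by
  rcases isEmpty_or_nonempty (Fin n) with h | h
  · exact ⟨1, one_pos, by simp [Subsingleton.elim (NormedSpace.exp B) 0]⟩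
  have hr : spectralRadius ℂ (NormedSpace.exp B) < (1 : NNReal) := by
    refine spectrum.spectralRadius_lt_of_forall_lt _ fun z hz => ?_
    obtain ⟨μ, hμ, rfl⟩ := exists_eigenvalue_of_mem_spectrum_exp hz
    rw [← NNReal.coe_lt_coe, coe_nnnorm, Complex.norm_exp, NNReal.coe_one, Real.exp_lt_one_iff]
    exact hB μ hμ
  have h1 := spectrum.pow_norm_pow_one_div_tendsto_nhds_spectralRadius (NormedSpace.exp B)
  obtain ⟨N, hN, hN0⟩ := ((h1.eventually_lt_const hr).and (eventually_gt_atTop 0)).exists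
  refine ⟨N, hN0, ?_⟩
  have h2 : NormedSpace.exp ((N : ℝ) • B) = NormedSpace.exp B ^ N := by
    rw [← Matrix.exp_nsmul, Nat.cast_smul_eq_nsmul]
  rw [h2]
  by_contra hcon
  have h3 : (1 : ℝ) ≤ ‖NormedSpace.exp B ^ N‖ ^ (1 / (N : ℝ)) :=
    Real.one_le_rpow (not_lt.mp hcon) (by positivity)
  refine absurd hN (not_lt.mpr ?_)
  simpa using ENNReal.ofReal_le_ofReal h3

theorem exists_norm_exp_smul_le {B : Matrix (Fin n) (Fin n) ℂ}
    (hB : ∀ μ : ℂ, Module.End.HasEigenvalue (Matrix.toLin' B) μ → μ.re < 0) :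
    ∃ C c : ℝ, 0 < c ∧ ∀ t : ℝ, 0 ≤ t → ‖NormedSpace.exp (t • B)‖ ≤ C * Real.exp (-c * t) := by
  obtain ⟨N, hN, hlt⟩ := exists_norm_exp_nsmul_lt_one hB
  have hN' : (0 : ℝ) < N := by exact_mod_cast hN
  obtain ⟨r, hr1, hr2⟩ := exists_between hlt
  have hr0 : 0 < r := (norm_nonneg _).trans_lt hr1
  have hcont : Continuous fun t : ℝ => NormedSpace.exp (t • B) :=
    continuous_iff_continuousAt.mpr fun t => (hasDerivAt_exp_smul_const' B t).continuousAt
  obtain ⟨K, hK⟩ := (isCompact_Icc (a := (0 : ℝ)) (b := N)).exists_bound_of_continuousOn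
    hcont.continuousOn
  have hK0 : 0 ≤ K := (norm_nonneg _).trans (hK 0 ⟨le_rfl, hN'.le⟩)
  have hlog : Real.log r < 0 := Real.log_neg hr0 hr2
  refine ⟨K * r⁻¹, -Real.log r / N, by apply div_pos <;> linarith, fun t ht => ?_⟩
  -- write `t = m N + s` with `0 ≤ s ≤ N`, so that `exp (t B) = (exp (N B)) ^ m * exp (s B)`
  set m := ⌊t / N⌋₊
  have hm1 : (m : ℝ) ≤ t / N := Nat.floor_le (by positivity)
  have hm2 : t / N < m + 1 := Nat.lt_floor_add_one _
  have hs : t - m * N ∈ Set.Icc (0 : ℝ) N := by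
    rw [le_div_iff₀ hN'] at hm1
    rw [div_lt_iff₀ hN'] at hm2
    constructor <;> linarith
  have hsplit : NormedSpace.exp (t • B)
      = NormedSpace.exp ((N : ℝ) • B) ^ m * NormedSpace.exp ((t - m * N) • B) := by
    rw [← Matrix.exp_nsmul, ← Matrix.exp_add_of_commute]
    · congr 1
      rw [← Nat.cast_smul_eq_nsmul ℝ, smul_smul, ← add_smul]
      congr 1; ring
    · exact (((Commute.refl B).smul_left _).smul_left _).smul_right _
  -- `m = 0` is separate: matrices over a possibly empty index type have no `NormOneClass`
  have hpow : ‖NormedSpace.exp ((N : ℝ) • B) ^ m‖ ≤ r ^ m ∨ m = 0 := by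
    rcases Nat.eq_zero_or_pos m with h | h
    · exact Or.inr h
    · exact Or.inl ((norm_pow_le' _ h).trans (pow_le_pow_left₀ (norm_nonneg _) hr1.le m))
  have h1 : ‖NormedSpace.exp (t • B)‖ ≤ r ^ m * K := by
    rcases hpow with h | h
    · rw [hsplit]
      exact (norm_mul_le _ _).trans (mul_le_mul h (hK _ hs) (norm_nonneg _) (by positivity))
    · rw [hsplit, h]
      simpa [h] using hK _ hs
  have h2 : r ^ m ≤ r⁻¹ * Real.exp (-(-Real.log r / N) * t) := by
    have : r⁻¹ * Real.exp (-(-Real.log r / N) * t) = Real.exp (Real.log r * (t / N - 1)) := by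
      rw [← Real.exp_log (inv_pos.mpr hr0), ← Real.exp_add, Real.log_inv]
      congr 1; ring
    rw [this, ← Real.rpow_natCast, Real.rpow_def_of_pos hr0]
    exact Real.exp_le_exp.mpr (mul_le_mul_of_nonpos_left (by linarith) hlog.le)
  calc ‖NormedSpace.exp (t • B)‖ ≤ r ^ m * K := h1
    _ ≤ (r⁻¹ * Real.exp (-(-Real.log r / N) * t)) * K := by gcongr
    _ = _ := by ring

theorem exp_map_ofReal (M : Matrix (Fin n) (Fin n) ℝ) :
    NormedSpace.exp (M.map (fun x : ℝ => (x : ℂ)))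
      = (NormedSpace.exp M).map (fun x : ℝ => (x : ℂ)) := by
  let _ : NormedAlgebra ℚ (Matrix (Fin n) (Fin n) ℝ) := .restrictScalars ℚ ℝ _
  exact (NormedSpace.map_exp (Complex.ofRealHom.mapMatrix (m := Fin n))
    (Continuous.matrix_map continuous_id Complex.continuous_ofReal) M).symm

theorem exists_abs_exp_entry_le {A : Matrix (Fin n) (Fin n) ℝ} (hA : IsStable A) :
    ∃ C c : ℝ, 0 < c ∧ ∀ t : ℝ, 0 ≤ t → ∀ i j,
      |NormedSpace.exp (t • A) i j| ≤ C * Real.exp (-c * t) := by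
  obtain ⟨C, c, hc, h⟩ := exists_norm_exp_smul_le hA
  refine ⟨C, c, hc, fun t ht i j => le_trans ?_ (h t ht)⟩
  have h1 : t • A.map (fun x : ℝ => (x : ℂ)) = (t • A).map (fun x : ℝ => (x : ℂ)) := by
    ext i j; simp
  rw [h1, exp_map_ofReal]
  rw [Matrix.linfty_opNorm_def, ← NNReal.coe_mk _ (abs_nonneg _), NNReal.coe_le_coe]
  refine le_trans ?_ (Finset.le_sup (Finset.mem_univ i))
  refine le_trans (le_of_eq ?_) (Finset.single_le_sum (fun _ _ => zero_le) (Finset.mem_univ j))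
  ext
  simp

theorem hasDerivAt_exp_entry (A : Matrix (Fin n) (Fin n) ℝ) (t : ℝ) (i j : Fin n) :
    HasDerivAt (fun s : ℝ => NormedSpace.exp (s • A) i j)
      (∑ k, A i k * NormedSpace.exp (t • A) k j) t := by
  have h := hasDerivAt_exp_smul_const' A t
  let φ : Matrix (Fin n) (Fin n) ℝ →L[ℝ] ℝ :=
    ⟨Matrix.entryLinearMap ℝ ℝ i j, continuous_id.matrix_elem i j⟩
  exact φ.hasFDerivAt.comp_hasDerivAt t h

end Decay

/-! ### Gramians and the Lyapunov equation -/

section Gramian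

open MeasureTheory

variable {n : ℕ} {A : Matrix (Fin n) (Fin n) ℝ}

theorem gramian_apply (A : Matrix (Fin n) (Fin n) ℝ) (i a b : Fin n) :
    gramian A i a b = ∫ t in Set.Ioi (0 : ℝ),
      NormedSpace.exp (t • A) a i * NormedSpace.exp (t • A) b i := by
  simp only [gramian, Matrix.of_apply]
  congr 1; ext t
  rw [← Matrix.transpose_smul, Matrix.exp_transpose, Matrix.mul_vecMulVec, Matrix.vecMulVec_mul,
    Matrix.vecMulVec_apply]
  simp

theorem exp_entry_mul_isBigO (hA : IsStable A) (a b i j : Fin n) :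
    ∃ c : ℝ, 0 < c ∧
    (fun t : ℝ => NormedSpace.exp (t • A) a i * NormedSpace.exp (t • A) b j)
      =O[atTop] fun t => Real.exp (-c * t) := by
  obtain ⟨C, c, hc, h⟩ := exists_abs_exp_entry_le hA
  refine ⟨2 * c, by positivity, Asymptotics.IsBigO.of_bound (C * C) ?_⟩
  filter_upwards [eventually_ge_atTop 0] with t ht
  have e : Real.exp (-(2 * c) * t) = Real.exp (-c * t) * Real.exp (-c * t) := by
    rw [← Real.exp_add]; congr 1; ring
  rw [Real.norm_eq_abs, Real.norm_eq_abs, abs_mul, e, abs_of_pos (a := _ * _) (by positivity)]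
  calc _ ≤ (C * Real.exp (-c * t)) * (C * Real.exp (-c * t)) :=
        mul_le_mul (h t ht _ _) (h t ht _ _) (abs_nonneg _) ((abs_nonneg _).trans (h t ht a i))
    _ = _ := by ring

theorem continuous_exp_entry (A : Matrix (Fin n) (Fin n) ℝ) (i j : Fin n) :
    Continuous fun t : ℝ => NormedSpace.exp (t • A) i j :=
  continuous_iff_continuousAt.mpr fun t => (hasDerivAt_exp_entry A t i j).continuousAt

theorem integrableOn_exp_entry_mul (hA : IsStable A) (a b i j : Fin n) :
    IntegrableOn (fun t : ℝ => NormedSpace.exp (t • A) a i * NormedSpace.exp (t • A) b j)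
      (Set.Ioi 0) := by
  obtain ⟨c, hc, h⟩ := exp_entry_mul_isBigO hA a b i j
  exact integrable_of_isBigO_exp_neg hc
    ((continuous_exp_entry A a i).mul (continuous_exp_entry A b j)).continuousOn h

/-- The Lyapunov equation `A Wᵢ + Wᵢ Aᵀ = -eᵢ eᵢᵀ`, entrywise: integrate the derivative of
`exp (t A) eᵢ eᵢᵀ exp (t Aᵀ)` over `(0, ∞)`. -/
theorem lyapunov_gramian (hA : IsStable A) (i a b : Fin n) :
    ∑ k, A a k * gramian A i k b + ∑ k, A b k * gramian A i a k
      = -((1 : Matrix (Fin n) (Fin n) ℝ) a i * (1 : Matrix (Fin n) (Fin n) ℝ) b i) := by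
  set E : ℝ → Matrix (Fin n) (Fin n) ℝ := fun t => NormedSpace.exp (t • A) with hE
  have hint : ∀ a b : Fin n, IntegrableOn (fun t => E t a i * E t b i) (Set.Ioi 0) :=
    fun a b => integrableOn_exp_entry_mul hA a b i i
  have hder : ∀ t ∈ Set.Ici (0 : ℝ), HasDerivAt (fun s => E s a i * E s b i)
      (∑ k, A a k * (E t k i * E t b i) + ∑ k, A b k * (E t a i * E t k i)) t := by
    intro t _
    convert! (hasDerivAt_exp_entry A t a i).mul (hasDerivAt_exp_entry A t b i) using 1
    rw [Finset.sum_mul, Finset.mul_sum]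
    congr 1 <;> refine Finset.sum_congr rfl fun k _ => ?_ <;> simp only [hE] <;> ring
  have hlim : Tendsto (fun s => E s a i * E s b i) atTop (𝓝 0) := by
    obtain ⟨c, hc, h⟩ := exp_entry_mul_isBigO hA a b i i
    refine h.trans_tendsto (Real.tendsto_exp_atBot.comp ?_)
    exact tendsto_id.const_mul_atTop_of_neg (by linarith)
  have i1 : ∀ k ∈ Finset.univ, IntegrableOn (fun t => A a k * (E t k i * E t b i)) (Set.Ioi 0) :=
    fun k _ => (hint k b).const_mul _
  have i2 : ∀ k ∈ Finset.univ, IntegrableOn (fun t => A b k * (E t a i * E t k i)) (Set.Ioi 0) :=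
    fun k _ => (hint a k).const_mul _
  have h := integral_Ioi_of_hasDerivAt_of_tendsto' hder
    ((integrable_finsetSum _ i1).add (integrable_finsetSum _ i2)) hlim
  rw [integral_add (integrable_finsetSum _ i1) (integrable_finsetSum _ i2),
    integral_finsetSum _ i1, integral_finsetSum _ i2] at h
  simp only [integral_const_mul] at h
  simp only [gramian_apply]
  rw [h]
  simp [hE]

end Gramian

/-! ### Strict concavity of `log det` -/

section LogDet

variable {n : ℕ}

/-- Pencils of real symmetric matrices `M`, `N` with `M` positive definite diagonalize
simultaneously; only the resulting factorization of determinants is recorded. -/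
theorem exists_det_pencil {M N : Matrix (Fin n) (Fin n) ℝ} (hM : M.PosDef) (hN : N.PosDef) :
    ∃ (δ : ℝ) (l : Fin n → ℝ), 0 < δ ∧ (∀ i, 0 < l i) ∧
      (∀ a b : ℝ, (a • M + b • N).det = δ * ∏ i, (a + b * l i)) ∧ ((∀ i, l i = 1) → M = N) := by
  -- `M = Sᵀ S` with `S` invertible
  obtain ⟨S, hS⟩ : ∃ S : Matrix (Fin n) (Fin n) ℝ, M = S.transpose * S := by
    open scoped MatrixOrder in
    obtain ⟨S, hS⟩ := CStarAlgebra.nonneg_iff_eq_star_mul_self.mp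
      (Matrix.nonneg_iff_posSemidef.mpr hM.posSemidef)
    exact ⟨S, by
      rw [hS, Matrix.star_eq_conjTranspose, Matrix.conjTranspose_eq_transpose_of_trivial]⟩
  have hdetM := hM.det_pos
  have hSdet : IsUnit S.det := by
    rw [isUnit_iff_ne_zero]
    rintro h
    rw [hS, Matrix.det_mul, h, mul_zero] at hdetM
    exact hdetM.false
  -- `N = Sᵀ K S` with `K` positive definite
  set K := (S⁻¹).transpose * N * S⁻¹ with hKdef
  have hSS : S⁻¹ * S = 1 := Matrix.nonsing_inv_mul S hSdet
  have hSTST : S.transpose * (S⁻¹).transpose = 1 := by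
    rw [← Matrix.transpose_mul, hSS, Matrix.transpose_one]
  have hK : K.PosDef := by
    have := hN.conjTranspose_mul_mul_same (B := S⁻¹)
      (Matrix.mulVec_injective_iff_isUnit.mpr
        ((Matrix.isUnit_nonsing_inv_iff).mpr ((Matrix.isUnit_iff_isUnit_det S).mpr hSdet)))
    rwa [Matrix.conjTranspose_eq_transpose_of_trivial] at this
  have hNK : N = S.transpose * K * S := by
    calc N = (S.transpose * (S⁻¹).transpose) * N * (S⁻¹ * S) := by rw [hSS, hSTST]; simp
      _ = _ := by rw [hKdef]; simp only [Matrix.mul_assoc]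
  have hspec := hK.isHermitian.spectral_theorem
  set U : Matrix (Fin n) (Fin n) ℝ := hK.isHermitian.eigenvectorUnitary.1
  set l := hK.isHermitian.eigenvalues
  have hUU : U * star U = 1 := Unitary.coe_mul_star_self _
  have hKU : K = U * Matrix.diagonal l * star U := by
    rw [Unitary.conjStarAlgAut_apply] at hspec
    exact hspec
  refine ⟨M.det, l, hdetM, hK.eigenvalues_pos, fun a b => ?_, fun h => ?_⟩
  · have h1 : a • M + b • N
        = S.transpose * (U * Matrix.diagonal (fun i => a + b * l i) * star U) * S := by
      have : Matrix.diagonal (fun i => a + b * l i)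
          = a • (1 : Matrix _ _ ℝ) + b • Matrix.diagonal l := by
        ext i j
        rcases eq_or_ne i j with rfl | hij
        · simp
        · simp [hij]
      rw [this, hNK, hKU, hS]
      simp only [mul_add, add_mul, mul_smul_comm, smul_mul_assoc, mul_one, hUU]
    have hUdet : U.det * (star U).det = 1 := by rw [← Matrix.det_mul, hUU, Matrix.det_one]
    rw [h1, hS]
    simp only [Matrix.det_mul, Matrix.det_diagonal]
    linear_combination (S.transpose.det * S.det * ∏ i, (a + b * l i)) * hUdet
  · have : Matrix.diagonal l = (1 : Matrix (Fin n) (Fin n) ℝ) := by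
      rw [← Matrix.diagonal_one]; congr 1; ext i; exact h i
    rw [hNK, hKU, this, mul_one, hUU, mul_one, hS]

/-- Strict concavity of `log det` on the positive definite matrices: by `exists_det_pencil` it
reduces to that of `log` at the generalized eigenvalues, not all of which are `1` if `M ≠ N`. -/
theorem log_det_strictConcave {M N : Matrix (Fin n) (Fin n) ℝ} (hM : M.PosDef) (hN : N.PosDef)
    (hne : M ≠ N) {a b : ℝ} (ha : 0 < a) (hb : 0 < b) (hab : a + b = 1) :
    a * Real.log M.det + b * Real.log N.det < Real.log (a • M + b • N).det := by
  obtain ⟨δ, l, hδ, hl, hdet, hone⟩ := exists_det_pencil hM hN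
  have hM1 : M.det = δ := by simpa using hdet 1 0
  have hN1 : N.det = δ * ∏ i, l i := by simpa using hdet 0 1
  have hpos : ∀ i, 0 < a + b * l i := fun i => by have := hl i; positivity
  have hle : ∀ i, b * Real.log (l i) ≤ Real.log (a + b * l i) := fun i => by
    have := strictConcaveOn_log_Ioi.concaveOn.2 (Set.mem_Ioi.mpr one_pos) (Set.mem_Ioi.mpr (hl i))
      ha.le hb.le hab
    simpa using this
  obtain ⟨j, hj⟩ : ∃ j, l j ≠ 1 := by
    by_contra! h
    exact hne (hone h)
  have hlt : b * Real.log (l j) < Real.log (a + b * l j) := by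
    have := strictConcaveOn_log_Ioi.2 (Set.mem_Ioi.mpr one_pos) (Set.mem_Ioi.mpr (hl j))
      hj.symm ha hb hab
    simpa using this
  rw [hdet, hM1, hN1, Real.log_mul hδ.ne' (Finset.prod_pos fun i _ => hl i).ne',
    Real.log_mul hδ.ne' (Finset.prod_pos fun i _ => hpos i).ne',
    Real.log_prod (fun i _ => (hl i).ne'), Real.log_prod (fun i _ => (hpos i).ne')]
  have hsum := Finset.sum_lt_sum (fun i _ => hle i) ⟨j, Finset.mem_univ j, hlt⟩
  rw [← Finset.mul_sum] at hsum
  have : a * Real.log δ + b * Real.log δ = Real.log δ := by rw [← add_mul, hab, one_mul]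
  linarith

end LogDet

/-! ### The matrix `W(p)`, the feasible set and the sublevel sets -/

section WconProps

open MeasureTheory

variable {n : ℕ} {A : Matrix (Fin n) (Fin n) ℝ}

theorem Wcon_apply (A : Matrix (Fin n) (Fin n) ℝ) (p : Vec n) (a b : Fin n) :
    Wcon A p a b = ∑ i, p i * gramian A i a b := by
  simp [Wcon, Matrix.sum_apply]

theorem Wcon_smul_add_smul (A : Matrix (Fin n) (Fin n) ℝ) (a b : ℝ) (p q : Vec n) :
    Wcon A (a • p + b • q) = a • Wcon A p + b • Wcon A q := by
  simp [Wcon, add_smul, Finset.sum_add_distrib, Finset.smul_sum, smul_smul]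

theorem gramian_isHermitian (A : Matrix (Fin n) (Fin n) ℝ) (i : Fin n) :
    (gramian A i).IsHermitian := by
  ext a b
  simp [gramian_apply, mul_comm]

theorem Wcon_isHermitian (A : Matrix (Fin n) (Fin n) ℝ) (p : Vec n) : (Wcon A p).IsHermitian := by
  ext a b
  simp only [Matrix.conjTranspose_apply, star_trivial, Wcon_apply]
  exact Finset.sum_congr rfl fun i _ => by rw [← (gramian_isHermitian A i).apply a b, star_trivial]

/-- The quadratic form of `Wᵢ` at `x` is `∫ (eᵢᵀ exp (t Aᵀ) x)² dt`. -/
theorem gramian_posSemidef (hA : IsStable A) (i : Fin n) : (gramian A i).PosSemidef := by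
  refine Matrix.PosSemidef.of_dotProduct_mulVec_nonneg (gramian_isHermitian A i) fun x => ?_
  have h : star x ⬝ᵥ (gramian A i).mulVec x
      = ∫ t in Set.Ioi (0 : ℝ), (∑ a, x a * NormedSpace.exp (t • A) a i) ^ 2 := by
    have hsq : ∀ t : ℝ, (∑ a, x a * NormedSpace.exp (t • A) a i) ^ 2
        = ∑ a, ∑ b, x a * NormedSpace.exp (t • A) a i * (x b * NormedSpace.exp (t • A) b i) :=
      fun t => by rw [sq, Finset.sum_mul_sum]
    simp only [dotProduct, Matrix.mulVec, Pi.star_apply, star_trivial, gramian_apply, hsq,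
      Finset.mul_sum]
    have hint : ∀ a b : Fin n, IntegrableOn (fun t : ℝ => x a * NormedSpace.exp (t • A) a i *
        (x b * NormedSpace.exp (t • A) b i)) (Set.Ioi 0) := fun a b => by
      refine ((integrableOn_exp_entry_mul hA a b i i).const_mul (x a * x b)).congr
        (ae_of_all _ fun t => ?_)
      simp only
      ring
    rw [integral_finsetSum _ fun a _ => integrable_finsetSum _ fun b _ => hint a b]
    refine Finset.sum_congr rfl fun a _ => ?_
    rw [integral_finsetSum _ fun b _ => hint a b]
    refine Finset.sum_congr rfl fun b _ => ?_
    rw [mul_comm (∫ t in _, _) (x b), ← mul_assoc, ← integral_const_mul]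
    congr 1; ext t; ring
  rw [h]
  exact integral_nonneg fun t => sq_nonneg _

theorem Wcon_posSemidef (hA : IsStable A) {p : Vec n} (hp : ∀ i, 0 ≤ p i) :
    (Wcon A p).PosSemidef :=
  Matrix.posSemidef_sum _ fun i _ => (gramian_posSemidef hA i).smul (hp i)

/-- The Lyapunov equation `A W(p) + W(p) Aᵀ = -diag p`. -/
theorem lyapunov_Wcon (hA : IsStable A) (p : Vec n) :
    A * Wcon A p + Wcon A p * A.transpose = -Matrix.diagonal p.ofLp := by
  have h : ∀ i, A * gramian A i + gramian A i * A.transpose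
      = -Matrix.single i i (1 : ℝ) := fun i => by
    ext a b
    have := lyapunov_gramian hA i a b
    simp only [Matrix.add_apply, Matrix.mul_apply, Matrix.neg_apply, Matrix.transpose_apply,
      mul_comm (gramian A i a _), this, Matrix.one_apply, Matrix.single_apply]
    by_cases h1 : i = a <;> by_cases h2 : i = b <;> simp [h1, h2, Ne.symm, eq_comm]
  simp only [Wcon, Finset.mul_sum, Finset.sum_mul, ← Finset.sum_add_distrib, mul_smul_comm,
    smul_mul_assoc, ← smul_add, h]
  ext a b
  simp [Matrix.sum_apply, Matrix.single_apply, Matrix.diagonal_apply, ite_and]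

theorem Wcon_injective (hA : IsStable A) : Function.Injective (Wcon A) := by
  intro p q h
  have h1 := (lyapunov_Wcon hA p).symm.trans (h ▸ lyapunov_Wcon hA q)
  ext i
  simpa using congrFun (congrFun h1 i) i

/-- If all weights are positive then `W(p)` is positive definite: for `x` in the kernel of `W(p)`,
the Lyapunov equation gives `∑ pᵢ xᵢ² = 0`. -/
theorem Wcon_posDef (hA : IsStable A) {p : Vec n} (hp : ∀ i, 0 < p i) : (Wcon A p).PosDef := by
  have hpsd := Wcon_posSemidef hA fun i => (hp i).le
  refine Matrix.PosDef.of_dotProduct_mulVec_pos hpsd.isHermitian fun x hx => ?_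
  refine lt_of_le_of_ne (hpsd.dotProduct_mulVec_nonneg x) fun h0 => hx ?_
  have hW := (hpsd.dotProduct_mulVec_zero_iff x).mp h0.symm
  have hWt : Matrix.vecMul x (Wcon A p) = 0 := by
    rw [← Matrix.mulVec_transpose, ← Matrix.conjTranspose_eq_transpose_of_trivial,
      hpsd.isHermitian.eq, hW]
  have h := congrArg (fun M => x ⬝ᵥ M.mulVec x) (lyapunov_Wcon hA p)
  simp only [Matrix.add_mulVec, dotProduct_add, Matrix.neg_mulVec, dotProduct_neg] at h
  rw [← Matrix.mulVec_mulVec, hW, Matrix.mulVec_zero, dotProduct_zero, zero_add,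
    ← Matrix.mulVec_mulVec, Matrix.dotProduct_mulVec, hWt, zero_dotProduct] at h
  have h2 : ∑ i, x i * (p i * x i) = 0 := by
    simpa [dotProduct, Matrix.mulVec_diagonal] using h.symm
  ext i
  have h3 := (Finset.sum_eq_zero_iff_of_nonneg fun i _ => by
    nlinarith [mul_nonneg (hp i).le (mul_self_nonneg (x i))]).mp h2 i (Finset.mem_univ i)
  have := (hp i).ne'
  simpa [this] using h3

theorem uniform_mem_simplex (hn : 0 < n) : uniform n ∈ simplex n := by
  have : (n : ℝ) ≠ 0 := by positivity
  refine ⟨by simp [uniform, this], fun i => by simp [uniform]⟩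

theorem uniform_mem_feasible (hn : 0 < n) (hA : IsStable A) : uniform n ∈ feasible A :=
  ⟨Wcon_posDef hA fun i => by simp [uniform, hn], uniform_mem_simplex hn⟩

theorem contDiff_det_Wcon (A : Matrix (Fin n) (Fin n) ℝ) {k : WithTop ℕ∞} :
    ContDiff ℝ k fun p => (Wcon A p).det := by
  simp only [Matrix.det_apply, Wcon_apply]
  fun_prop

/-- Positivity of the quadratic form has to be tested on the compact unit sphere only, so it
persists near `p`. -/
theorem isOpen_posDefSet (A : Matrix (Fin n) (Fin n) ℝ) : IsOpen (posDefSet A) := by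
  rw [isOpen_iff_mem_nhds]
  intro p hp
  have hc : Continuous fun z : Vec n × (Fin n → ℝ) => z.2 ⬝ᵥ (Wcon A z.1).mulVec z.2 := by
    simp only [dotProduct, Matrix.mulVec, Wcon_apply]
    fun_prop
  have hev : ∀ᶠ q in 𝓝 p, ∀ x ∈ Metric.sphere (0 : Fin n → ℝ) 1, 0 < x ⬝ᵥ (Wcon A q).mulVec x := by
    refine (isCompact_sphere _ _).eventually_forall_of_forall_eventually fun x hx => ?_
    refine hc.continuousAt.eventually (lt_mem_nhds ?_)
    exact Matrix.PosDef.dotProduct_mulVec_pos hp (by rintro rfl; simp at hx)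
  filter_upwards [hev] with q hq
  refine Matrix.PosDef.of_dotProduct_mulVec_pos (Wcon_isHermitian A q) fun x hx => ?_
  have hx' : 0 < ‖x‖ := norm_pos_iff.mpr hx
  have h := hq (‖x‖⁻¹ • x) (by simp [norm_smul, hx'.ne'])
  rw [Matrix.mulVec_smul, dotProduct_smul, smul_dotProduct] at h
  simp only [smul_eq_mul] at h
  rw [star_trivial]
  by_contra hcon
  have := mul_nonpos_of_nonneg_of_nonpos (inv_nonneg.mpr hx'.le) (not_lt.mp hcon)
  have := mul_nonpos_of_nonneg_of_nonpos (inv_nonneg.mpr hx'.le) this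
  linarith

theorem contDiffAt_objective {p : Vec n} (hp : p ∈ posDefSet A) {k : WithTop ℕ∞} :
    ContDiffAt ℝ k (objective A) p :=
  ((contDiff_det_Wcon A).contDiffAt.log (Matrix.PosDef.det_pos hp).ne').neg

theorem convex_posDefSet (A : Matrix (Fin n) (Fin n) ℝ) : Convex ℝ (posDefSet A) := by
  intro p hp q hq a b ha hb hab
  change (Wcon A _).PosDef
  rw [Wcon_smul_add_smul]
  rcases ha.eq_or_lt with rfl | ha
  · simp only [zero_add] at hab
    rw [hab, zero_smul, zero_add, one_smul]
    exact hq
  · exact (Matrix.PosDef.smul hp ha).add_posSemidef ((Matrix.PosDef.posSemidef hq).smul hb)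

theorem strictConvexOn_objective (hA : IsStable A) :
    StrictConvexOn ℝ (posDefSet A) (objective A) := by
  refine ⟨convex_posDefSet A, fun p hp q hq hpq a b ha hb hab => ?_⟩
  have := log_det_strictConcave hp hq ((Wcon_injective hA).ne hpq) ha hb hab
  simp only [objective, Wcon_smul_add_smul, smul_eq_mul]
  linarith

theorem isClosed_simplex (n : ℕ) : IsClosed (simplex n) := by
  refine IsClosed.inter (isClosed_eq (by fun_prop) continuous_const) ?_
  change IsClosed {p : Vec n | ∀ i, 0 ≤ p i}
  rw [Set.ofPred_forall]
  exact isClosed_iInter fun i => isClosed_le continuous_const (by fun_prop)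

theorem convex_simplex (n : ℕ) : Convex ℝ (simplex n) := by
  intro p hp q hq a b ha hb hab
  refine ⟨?_, fun i => ?_⟩
  · simp [Finset.sum_add_distrib, ← Finset.mul_sum, hp.1, hq.1, hab]
  · have h1 := hp.2 i
    have h2 := hq.2 i
    simp only [PiLp.add_apply, PiLp.smul_apply, smul_eq_mul]
    positivity

theorem norm_le_one_of_mem_simplex {p : Vec n} (hp : p ∈ simplex n) : ‖p‖ ≤ 1 := by
  have h1 : ∀ i, p i ≤ 1 := fun i =>
    (Finset.single_le_sum (fun j _ => hp.2 j) (Finset.mem_univ i)).trans hp.1.le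
  rw [EuclideanSpace.norm_eq, Real.sqrt_le_one, ← hp.1]
  refine Finset.sum_le_sum fun i _ => ?_
  rw [Real.norm_eq_abs, sq_abs]
  nlinarith [hp.2 i, h1 i]

theorem isCompact_simplex (n : ℕ) : IsCompact (simplex n) :=
  (isCompact_closedBall (0 : Vec n) 1).of_isClosed_subset (isClosed_simplex n) fun p hp => by
    simpa using norm_le_one_of_mem_simplex hp

theorem convex_feasible (A : Matrix (Fin n) (Fin n) ℝ) : Convex ℝ (feasible A) :=
  (convex_posDefSet A).inter (convex_simplex n)

theorem strictConvexOn_objective_feasible (hA : IsStable A) :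
    StrictConvexOn ℝ (feasible A) (objective A) :=
  (strictConvexOn_objective hA).subset Set.inter_subset_left (convex_feasible A)

/-- On the simplex `W(p)` is positive semidefinite, so the sublevel set can be described by the
determinant alone, which makes it visibly closed. -/
theorem sublevel_eq (hA : IsStable A) {p₀ : Vec n} (h₀ : p₀ ∈ posDefSet A) :
    sublevel A p₀ = {p | (Wcon A p₀).det ≤ (Wcon A p).det} ∩ simplex n := by
  have hdet₀ : 0 < (Wcon A p₀).det := Matrix.PosDef.det_pos h₀
  ext p
  constructor
  · rintro ⟨h1, h2, h3⟩
    exact ⟨(Real.log_le_log_iff hdet₀ (Matrix.PosDef.det_pos h2)).mp (neg_le_neg_iff.mp h1), h3⟩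
  · rintro ⟨h1, h3⟩
    have hp : 0 < (Wcon A p).det := hdet₀.trans_le h1
    exact ⟨neg_le_neg (Real.log_le_log hdet₀ h1),
      (Wcon_posSemidef hA h3.2).posDef_iff_det_ne_zero.mpr hp.ne', h3⟩

theorem isCompact_sublevel (hA : IsStable A) {p₀ : Vec n} (h₀ : p₀ ∈ posDefSet A) :
    IsCompact (sublevel A p₀) := by
  rw [sublevel_eq hA h₀]
  exact (isCompact_simplex n).inter_left
    (isClosed_le continuous_const (contDiff_det_Wcon A (k := 0)).continuous)

theorem convex_sublevel (hA : IsStable A) (p₀ : Vec n) : Convex ℝ (sublevel A p₀) := by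
  have h : sublevel A p₀ = {p ∈ feasible A | objective A p ≤ objective A p₀} :=
    Set.ext fun _ => and_comm
  rw [h]
  exact (strictConvexOn_objective_feasible hA).convexOn.convex_le _

theorem convexOn_objective_sublevel (hA : IsStable A) (p₀ : Vec n) :
    ConvexOn ℝ (sublevel A p₀) (objective A) :=
  (strictConvexOn_objective_feasible hA).convexOn.subset Set.inter_subset_right
    (convex_sublevel hA p₀)

end WconProps

/-! ### Projected gradient steps and the Armijo test -/

section GradientStep

variable {n : ℕ} {A : Matrix (Fin n) (Fin n) ℝ}

theorem inner_sub_proj_le_zero {C : Set (Vec n)} (hC : IsClosed C) (hconv : Convex ℝ C)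
    (q : Vec n) {r : Vec n} (hr : r ∈ C) :
    inner ℝ (q - proj C q) (r - proj C q) ≤ 0 := by
  obtain ⟨h1, h2⟩ := proj_spec ⟨r, hr⟩ hC q
  refine (norm_eq_iInf_iff_real_inner_le_zero hconv h1).mp (le_antisymm ?_ ?_) r hr
  · have : Nonempty C := ⟨⟨r, hr⟩⟩
    refine le_ciInf fun w => ?_
    rw [norm_sub_rev q, norm_sub_rev q]
    exact le_of_sq_le_sq (h2 w.2) (norm_nonneg _)
  · exact ciInf_le ⟨0, by rintro _ ⟨w, rfl⟩; exact norm_nonneg _⟩ (⟨_, h1⟩ : C)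

theorem trial_mem_simplex {p : Vec n} (hp : p ∈ simplex n) (a : ℝ) : trial A p a ∈ simplex n :=
  (proj_spec ⟨p, hp⟩ (isClosed_simplex n) _).1

/-- The variational inequality that characterizes the projection, at a trial point. -/
theorem mul_inner_gradient_trial_sub_le (p : Vec n) (a : ℝ) {r : Vec n} (hr : r ∈ simplex n) :
    a * inner ℝ (gradient (objective A) p) (trial A p a - r)
      ≤ inner ℝ (p - trial A p a) (trial A p a - r) := by
  have h := inner_sub_proj_le_zero (isClosed_simplex n) (convex_simplex n)
    (p - a • gradient (objective A) p) hr
  change inner ℝ (p - a • gradient (objective A) p - trial A p a) (r - trial A p a) ≤ 0 at h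
  rw [sub_right_comm, inner_sub_left, real_inner_smul_left, ← neg_sub (trial A p a) r,
    inner_neg_right, inner_neg_right] at h
  linarith

/-- The projected step is a descent direction, with the quantitative bound
`a ⟨∇f(p), p̃ - p⟩ ≤ -‖p̃ - p‖²`. -/
theorem mul_inner_gradient_trial_sub_self_le {p : Vec n} (hp : p ∈ simplex n) (a : ℝ) :
    a * inner ℝ (gradient (objective A) p) (trial A p a - p) ≤ -‖trial A p a - p‖ ^ 2 := by
  have h := mul_inner_gradient_trial_sub_le (A := A) p a hp
  rwa [← neg_sub (trial A p a) p, inner_neg_left, real_inner_self_eq_norm_sq] at h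

theorem norm_trial_sub_le {p : Vec n} (hp : p ∈ simplex n) {a : ℝ} (ha : 0 ≤ a) :
    ‖trial A p a - p‖ ≤ a * ‖gradient (objective A) p‖ := by
  have h1 := mul_inner_gradient_trial_sub_self_le (A := A) hp a
  have h2 := mul_le_mul_of_nonneg_left (neg_le_of_abs_le
    (abs_real_inner_le_norm (gradient (objective A) p) (trial A p a - p))) ha
  rcases (norm_nonneg (trial A p a - p)).eq_or_lt with h0 | h0
  · rw [← h0]; positivity
  · refine le_of_mul_le_mul_right ?_ h0
    nlinarith

theorem inner_gradient_eq (f : Vec n → ℝ) (p v : Vec n) :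
    inner ℝ (gradient f p) v = fderiv ℝ f p v :=
  InnerProductSpace.toDual_symm_apply

theorem norm_gradient_eq (f : Vec n → ℝ) (p : Vec n) : ‖gradient f p‖ = ‖fderiv ℝ f p‖ :=
  LinearIsometryEquiv.norm_map _ _

theorem contDiffAt_fderiv_objective {p : Vec n} (hp : p ∈ posDefSet A) :
    ContDiffAt ℝ 1 (fderiv ℝ (objective A)) p :=
  (contDiffAt_objective hp (k := 2)).fderiv_right (by norm_num)

/-- Near every point of `X` all sufficiently small steps pass the Armijo test, because the gradient
is Lipschitz there. -/
theorem exists_nhds_armijoTest {σ : ℝ} (hσ : σ < 1) {x : Vec n} (hx : x ∈ posDefSet A) :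
    ∃ U ∈ 𝓝 x, ∃ b : ℝ, 0 < b ∧
      ∀ p ∈ U ∩ simplex n, ∀ a : ℝ, 0 < a → a ≤ b → ArmijoTest A σ p a := by
  obtain ⟨K, t, ht, hLip⟩ := (contDiffAt_fderiv_objective hx).exists_lipschitzOnWith
  obtain ⟨R, hR, hball⟩ := Metric.mem_nhds_iff.mp
    (inter_mem ht ((isOpen_posDefSet A).mem_nhds hx))
  set G := ‖fderiv ℝ (objective A) x‖ + K * R with hGdef
  have hG0 : 0 ≤ G := by positivity
  have hG : ∀ p ∈ Metric.ball x R, ‖fderiv ℝ (objective A) p‖ ≤ G := by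
    intro p hp
    have h1 := hLip.dist_le_mul p (hball hp).1 x (mem_of_mem_nhds ht)
    rw [dist_eq_norm] at h1
    have h2 : (K : ℝ) * dist p x ≤ K * R :=
      mul_le_mul_of_nonneg_left (Metric.mem_ball.mp hp).le K.2
    have h3 := norm_le_norm_add_norm_sub' (fderiv ℝ (objective A) p) (fderiv ℝ (objective A) x)
    linarith
  -- the first bound keeps the trial point in the ball of radius `R`, the second absorbs the
  -- quadratic error term `K ‖q - p‖²` into `(1 - σ)` times the predicted decrease
  refine ⟨Metric.ball x (R / 2), Metric.ball_mem_nhds x (by positivity),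
    min (R / 2 / (G + 1)) ((1 - σ) / (K + 1)), ?_, ?_⟩
  · have : 0 < 1 - σ := by linarith
    positivity
  rintro p ⟨hpU, hpS⟩ a ha hab
  have hp : p ∈ Metric.ball x R := Metric.ball_subset_ball (by linarith) hpU
  have ha1 : a * (G + 1) ≤ R / 2 :=
    (le_div_iff₀ (by positivity)).mp (hab.trans (min_le_left _ _))
  have ha2 : a * (K + 1) ≤ 1 - σ :=
    (le_div_iff₀ (by positivity)).mp (hab.trans (min_le_right _ _))
  set q := trial A p a with hq
  have hqp : ‖q - p‖ ≤ R / 2 := by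
    have h1 := norm_trial_sub_le (A := A) hpS ha.le
    rw [norm_gradient_eq] at h1
    have h2 := mul_le_mul_of_nonneg_left (hG p hp) ha.le
    rw [← hq] at h1
    linarith
  have hqB : q ∈ Metric.ball x R := by
    have h1 := dist_triangle q p x
    rw [dist_eq_norm q p] at h1
    have h2 := Metric.mem_ball.mp hpU
    rw [Metric.mem_ball]
    linarith
  have hseg : segment ℝ p q ⊆ Metric.ball x R := (convex_ball x R).segment_subset hp hqB
  have hTaylor := (convex_segment p q).norm_image_sub_le_of_norm_hasFDerivWithin_le'
    (f := objective A) (f' := fderiv ℝ (objective A)) (φ := fderiv ℝ (objective A) p)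
    (C := K * ‖q - p‖)
    (fun z hz => ((contDiffAt_objective (hball (hseg hz)).2 (k := 1)).differentiableAt
      one_ne_zero).hasFDerivAt.hasFDerivWithinAt)
    (fun z hz => by
      have h1 := hLip.dist_le_mul z (hball (hseg hz)).1 p (hball hp).1
      rw [dist_eq_norm, dist_eq_norm] at h1
      exact h1.trans (mul_le_mul_of_nonneg_left (norm_sub_le_of_mem_segment hz) K.2))
    (left_mem_segment ℝ p q) (right_mem_segment ℝ p q)
  refine ⟨(hball hqB).2, ?_⟩
  rw [inner_gradient_eq]
  have h1 := (abs_le.mp hTaylor).2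
  have h2 := mul_inner_gradient_trial_sub_self_le (A := A) hpS a
  rw [inner_gradient_eq, ← hq] at h2
  set D := fderiv ℝ (objective A) p (q - p)
  have hD : D ≤ 0 := by
    by_contra hcon
    have := mul_pos ha (not_le.mp hcon)
    nlinarith [sq_nonneg ‖q - p‖]
  have h3 : K * ‖q - p‖ * ‖q - p‖ ≤ -(1 - σ) * D := by
    have e1 : (K : ℝ) * ‖q - p‖ ^ 2 ≤ K * -(a * D) :=
      mul_le_mul_of_nonneg_left (by linarith) K.2
    have e2 : (a * K) * -D ≤ (1 - σ) * -D :=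
      mul_le_mul_of_nonneg_right (by linarith) (by linarith)
    nlinarith
  linarith

/-- On a compact sublevel set a single threshold works for the Armijo test at all points. -/
theorem exists_forall_armijoTest (hA : IsStable A) {σ : ℝ} (hσ : σ < 1) {p₀ : Vec n}
    (h₀ : p₀ ∈ posDefSet A) :
    ∃ b : ℝ, 0 < b ∧ ∀ p ∈ sublevel A p₀, ∀ a : ℝ, 0 < a → a ≤ b → ArmijoTest A σ p a := by
  suffices h : ∃ b : ℝ, 0 < b ∧ ∀ p ∈ sublevel A p₀ ∩ simplex n, ∀ a : ℝ, 0 < a → a ≤ b →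
      ArmijoTest A σ p a by
    obtain ⟨b, hb, h⟩ := h
    exact ⟨b, hb, fun p hp => h p ⟨hp, hp.2.2⟩⟩
  refine (isCompact_sublevel hA h₀).induction_on (p := fun S => ∃ b : ℝ, 0 < b ∧
    ∀ p ∈ S ∩ simplex n, ∀ a : ℝ, 0 < a → a ≤ b → ArmijoTest A σ p a) ⟨1, one_pos, by simp⟩
    ?_ ?_ fun x hx => ?_
  · rintro S T hST ⟨b, hb, h⟩
    exact ⟨b, hb, fun p hp => h p ⟨hST hp.1, hp.2⟩⟩
  · rintro S T ⟨b, hb, h⟩ ⟨c, hc, h'⟩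
    refine ⟨min b c, lt_min hb hc, ?_⟩
    rintro p ⟨hp | hp, hps⟩ a ha hab
    · exact h p ⟨hp, hps⟩ a ha (hab.trans (min_le_left _ _))
    · exact h' p ⟨hp, hps⟩ a ha (hab.trans (min_le_right _ _))
  · obtain ⟨U, hU, h⟩ := exists_nhds_armijoTest hσ hx.2.1
    exact ⟨U, mem_nhdsWithin_of_mem_nhds hU, h⟩

theorem exists_isArmijoStep {σ ρ α : ℝ} (hρ : ρ ∈ Set.Ioo (0 : ℝ) 1) (hα : 0 < α) {p : Vec n}
    {b : ℝ} (hb : 0 < b) (h : ∀ a : ℝ, 0 < a → a ≤ b → ArmijoTest A σ p a) :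
    ∃ a, IsArmijoStep A σ ρ α p a := by
  classical
  have hex : ∃ m : ℕ, ArmijoTest A σ p (ρ ^ m * α) := by
    obtain ⟨m, hm⟩ := exists_pow_lt_of_lt_one (div_pos hb hα) hρ.2
    exact ⟨m, h _ (mul_pos (pow_pos hρ.1 m) hα) ((lt_div_iff₀ hα).mp hm).le⟩
  exact ⟨_, Nat.find hex, rfl, Nat.find_spec hex, fun j hj => Nat.find_min hex hj⟩

theorem IsArmijoStep.pos {σ ρ α : ℝ} (hρ : ρ ∈ Set.Ioo (0 : ℝ) 1) (hα : 0 < α) {p : Vec n} {a : ℝ}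
    (ha : IsArmijoStep A σ ρ α p a) : 0 < a := by
  obtain ⟨m, rfl, -⟩ := ha
  exact mul_pos (pow_pos hρ.1 m) hα

theorem IsArmijoStep.le {σ ρ α : ℝ} (hρ : ρ ∈ Set.Ioo (0 : ℝ) 1) (hα : 0 < α) {p : Vec n} {a : ℝ}
    (ha : IsArmijoStep A σ ρ α p a) : a ≤ α := by
  obtain ⟨m, rfl, -⟩ := ha
  exact mul_le_of_le_one_left hα.le (pow_le_one₀ hρ.1.le hρ.2.le)

/-- Backtracking overshoots the threshold `b` by at most one factor `ρ`. -/
theorem IsArmijoStep.min_le {σ ρ α : ℝ} (hρ : ρ ∈ Set.Ioo (0 : ℝ) 1) (hα : 0 < α) {p : Vec n}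
    {a b : ℝ} (h : ∀ a : ℝ, 0 < a → a ≤ b → ArmijoTest A σ p a)
    (ha : IsArmijoStep A σ ρ α p a) : min α (ρ * b) ≤ a := by
  obtain ⟨m, rfl, -, hm⟩ := ha
  rcases m with _ | m
  · simp
  · refine (min_le_right _ _).trans ?_
    have h1 : b < ρ ^ m * α := by
      by_contra hcon
      exact hm m (Nat.lt_succ_self m) (h _ (mul_pos (pow_pos hρ.1 m) hα) (not_lt.mp hcon))
    rw [pow_succ', mul_assoc]
    exact mul_le_mul_of_nonneg_left h1.le hρ.1.le

theorem IsArmijoStep.armijoTest {σ ρ α : ℝ} {p : Vec n} {a : ℝ}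
    (ha : IsArmijoStep A σ ρ α p a) : ArmijoTest A σ p a := by
  obtain ⟨m, rfl, h, -⟩ := ha
  exact h

/-- The sufficient decrease guaranteed by the Armijo test. -/
theorem ArmijoTest.objective_trial_le {σ a : ℝ} (hσ : 0 ≤ σ) (ha : 0 < a) {p : Vec n}
    (hp : p ∈ simplex n) (h : ArmijoTest A σ p a) :
    objective A (trial A p a) ≤ objective A p - σ / a * ‖trial A p a - p‖ ^ 2 := by
  refine h.2.trans ?_
  have h1 := mul_inner_gradient_trial_sub_self_le (A := A) hp a
  have h2 : inner ℝ (gradient (objective A) p) (trial A p a - p)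
      ≤ -‖trial A p a - p‖ ^ 2 / a := by
    rw [le_div_iff₀ ha, mul_comm]; exact h1
  have h3 := mul_le_mul_of_nonneg_left h2 hσ
  calc _ ≤ objective A p + σ * (-‖trial A p a - p‖ ^ 2 / a) := by linarith
    _ = _ := by ring

theorem ArmijoTest.trial_mem_sublevel {σ a : ℝ} (hσ : 0 ≤ σ) (ha : 0 < a) {p p₀ : Vec n}
    (hp : p ∈ sublevel A p₀) (h : ArmijoTest A σ p a) : trial A p a ∈ sublevel A p₀ := by
  refine ⟨?_, h.1, trial_mem_simplex hp.2.2 a⟩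
  have h1 := h.objective_trial_le hσ ha hp.2.2
  have h2 : 0 ≤ σ / a * ‖trial A p a - p‖ ^ 2 := by positivity
  have h3 : objective A p ≤ objective A p₀ := hp.1
  change objective A _ ≤ _
  linarith

/-- The gradient inequality of the convex function `f`. -/
theorem objective_sub_le_inner_gradient (hA : IsStable A) {p q : Vec n} (hp : p ∈ posDefSet A)
    (hq : q ∈ posDefSet A) :
    objective A p - objective A q ≤ inner ℝ (gradient (objective A) p) (p - q) := by
  -- restrict `f` to the line through `p` and `q`
  let L : ℝ →ᵃ[ℝ] Vec n := AffineMap.lineMap p q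
  have hconv := (strictConvexOn_objective hA).convexOn.comp_affineMap L
  have h0 : L 0 = p := AffineMap.lineMap_apply_zero _ _
  have h1 : L 1 = q := AffineMap.lineMap_apply_one _ _
  have hd : HasDerivAt (objective A ∘ L) (fderiv ℝ (objective A) p (q - p)) 0 := by
    have hf := ((contDiffAt_objective hp (k := 1)).differentiableAt one_ne_zero).hasFDerivAt
    rw [← h0] at hf
    have hL : HasDerivAt L (q - p) (0 : ℝ) := AffineMap.hasDerivAt_lineMap
    simpa only [h0] using hf.comp_hasDerivAt (0 : ℝ) hL
  have h := hconv.le_slope_of_hasDerivAt (x := 0) (y := 1) (by simpa [h0] using hp)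
    (by simpa [h1] using hq) one_pos hd
  rw [slope_def_field] at h
  simp only [Function.comp, h0, h1, sub_zero, div_one] at h
  rw [← neg_sub q p, inner_neg_right, inner_gradient_eq]
  linarith

/-- The optimality gap is controlled by the length of the projected gradient step: split
`⟨∇f(p), p - q⟩` at the trial point. The constant `2` bounds the diameter of the simplex. -/
theorem objective_sub_le_norm_trial_sub (hA : IsStable A) {p q : Vec n} (hp : p ∈ feasible A)
    (hq : q ∈ feasible A) {a : ℝ} (ha : 0 < a) :
    objective A p - objective A q
      ≤ (‖gradient (objective A) p‖ + 2 / a) * ‖trial A p a - p‖ := by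
  set g := gradient (objective A) p
  set t := trial A p a with ht
  have h1 := objective_sub_le_inner_gradient hA hp.1 hq.1
  have h2 : inner ℝ g (p - q) = inner ℝ g (p - t) + inner ℝ g (t - q) := by
    rw [← inner_add_right]; congr 1; abel
  have h3 : inner ℝ g (p - t) ≤ ‖g‖ * ‖t - p‖ := by
    rw [norm_sub_rev t p]; exact real_inner_le_norm _ _
  have h4 : inner ℝ g (t - q) ≤ 2 / a * ‖t - p‖ := by
    have e1 := mul_inner_gradient_trial_sub_le (A := A) p a hq.2
    have e2 := real_inner_le_norm (p - t) (t - q)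
    have e3 : ‖t - q‖ ≤ 2 := by
      have := norm_sub_le t q
      have := norm_le_one_of_mem_simplex (trial_mem_simplex (A := A) hp.2 a)
      have := norm_le_one_of_mem_simplex hq.2
      linarith
    have e4 := mul_le_mul_of_nonneg_left e3 (norm_nonneg (p - t))
    rw [div_mul_eq_mul_div, le_div_iff₀ ha, norm_sub_rev t p, mul_comm]
    exact (e1.trans e2).trans (by linarith)
  linarith

theorem exists_norm_gradient_le (hA : IsStable A) {p₀ : Vec n} (h₀ : p₀ ∈ posDefSet A) :
    ∃ G : ℝ, ∀ p ∈ sublevel A p₀, ‖gradient (objective A) p‖ ≤ G := by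
  obtain ⟨G, hG⟩ := (isCompact_sublevel hA h₀).exists_bound_of_continuousOn
    (f := fderiv ℝ (objective A)) fun p hp =>
      (contDiffAt_fderiv_objective hp.2.1).continuousAt.continuousWithinAt
  exact ⟨G, fun p hp => (norm_gradient_eq _ p).trans_le (hG p hp)⟩

end GradientStep

/-! ### Minimizers -/

section Solutions

variable {n : ℕ} {A : Matrix (Fin n) (Fin n) ℝ}

/-- Feasible points outside the sublevel set have larger objective value than `p₀`, so they do not
matter for minimization. -/
theorem isVCS_iff_isSolution_sublevel {p₀ : Vec n} (h₀ : p₀ ∈ feasible A) (q : Vec n) :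
    IsVCS A q ↔ IsSolution (objective A) (sublevel A p₀) q := by
  constructor
  · rintro ⟨h1, h2⟩
    exact ⟨⟨h2 h₀, h1⟩, h2.on_subset Set.inter_subset_right⟩
  · rintro ⟨h1, h2⟩
    refine ⟨h1.2, fun r hr => ?_⟩
    rcases le_total (objective A r) (objective A p₀) with h | h
    · exact h2 ⟨h, hr⟩
    · exact le_trans h1.1 h

theorem exists_isVCS_iff_eq (hA : IsStable A) {p₀ : Vec n} (h₀ : p₀ ∈ feasible A) :
    ∃ pstar : Vec n, ∀ q, IsVCS A q ↔ q = pstar := by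
  obtain ⟨x, hx, hmin⟩ := (isCompact_sublevel hA h₀.1).exists_isMinOn
    ⟨p₀, le_refl (objective A p₀), h₀⟩ fun p hp =>
      (contDiffAt_objective hp.2.1 (k := 0)).continuousAt.continuousWithinAt
  have hxV : IsVCS A x := (isVCS_iff_isSolution_sublevel h₀ x).mpr ⟨hx, hmin⟩
  refine ⟨x, fun q => ⟨fun hq => ?_, fun h => h ▸ hxV⟩⟩
  exact (strictConvexOn_objective_feasible hA).eq_of_isMinOn hq.2 hxV.2 hq.1 hxV.1

end Solutions

/-! ### Convergence of the iterates -/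

section Run

variable {n : ℕ} {A : Matrix (Fin n) (Fin n) ℝ} {σ ρ α : ℝ} {p : ℕ → Vec n} {a : ℕ → ℝ}

theorem IsRun.mem_sublevel (hn : 0 < n) (hA : IsStable A) (hσ : 0 < σ)
    (hρ : ρ ∈ Set.Ioo (0 : ℝ) 1) (hα : 0 < α) (h : IsRun A σ ρ α 0 p a) (k : ℕ) :
    p k ∈ sublevel A (uniform n) := by
  induction k with
  | zero => rw [h.init]; exact ⟨le_refl (objective A _), uniform_mem_feasible hn hA⟩
  | succ k ih =>
    by_cases hs : Stopped 0 p k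
    · rw [h.hold k hs]; exact ih
    · have ha := h.armijo k hs
      rw [h.step k hs]
      exact ha.armijoTest.trial_mem_sublevel hσ.le (ha.pos hρ hα) ih

theorem IsRun.step_eq_proj_sublevel (hn : 0 < n) (hA : IsStable A) (hσ : 0 < σ)
    (hρ : ρ ∈ Set.Ioo (0 : ℝ) 1) (hα : 0 < α) (h : IsRun A σ ρ α 0 p a) {k : ℕ}
    (hs : ¬ Stopped 0 p k) :
    p (k + 1) = proj (sublevel A (uniform n)) (p k - a k • gradient (objective A) (p k)) := by
  refine (proj_eq (convex_sublevel hA _) ⟨h.mem_sublevel hn hA hσ hρ hα (k + 1), ?_⟩).symm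
  rw [h.step k hs]
  exact (proj_spec ⟨_, uniform_mem_simplex hn⟩ (isClosed_simplex n) _).2.on_subset
    fun _ hr => hr.2.2

theorem exists_isRun (hn : 0 < n) (hA : IsStable A) (hσ : σ ∈ Set.Ioo (0 : ℝ) 1)
    (hρ : ρ ∈ Set.Ioo (0 : ℝ) 1) (hα : 0 < α) :
    ∃ (p : ℕ → Vec n) (a : ℕ → ℝ), IsRun A σ ρ α 0 p a := by
  have h₀ := uniform_mem_feasible hn hA
  obtain ⟨b, hb, htest⟩ := exists_forall_armijoTest hA hσ.2 h₀.1
  have hex : ∀ x : Vec n, ∃ s : ℝ, x ∈ sublevel A (uniform n) → IsArmijoStep A σ ρ α x s := by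
    intro x
    by_cases hx : x ∈ sublevel A (uniform n)
    · obtain ⟨s, hs⟩ := exists_isArmijoStep hρ hα hb (htest x hx)
      exact ⟨s, fun _ => hs⟩
    · exact ⟨0, fun h => absurd h hx⟩
  choose s hs using hex
  set p : ℕ → Vec n := fun k => Nat.rec (uniform n) (fun _ x => trial A x (s x)) k
  have hsucc : ∀ k, p (k + 1) = trial A (p k) (s (p k)) := fun k => rfl
  have hmem : ∀ k, p k ∈ sublevel A (uniform n) := by
    intro k
    induction k with
    | zero => exact ⟨le_refl (objective A _), h₀⟩
    | succ k ih =>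
      rw [hsucc]
      exact (hs _ ih).armijoTest.trial_mem_sublevel hσ.1.le ((hs _ ih).pos hρ hα) ih
  refine ⟨p, fun k => s (p k), rfl, fun k _ => hs _ (hmem k), fun k _ => rfl, ?_⟩
  -- the recursion is autonomous, so that it stays at a point which one step leaves fixed
  rintro k ⟨j, hj, hjk⟩
  have hfix : p (j + 1) = p j :=
    (sub_eq_zero.mp (norm_le_zero_iff.mp hjk)).symm
  have hconst : ∀ i, j ≤ i → p i = p j := by
    intro i hi
    induction i, hi using Nat.le_induction with
    | base => rfl
    | succ i _ ih => rw [hsucc, ih, ← hsucc, hfix]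
  rw [hconst k hj.le, hconst (k + 1) (by omega)]

/-- The gap bound with a constant uniform in `k`, as step sizes are bounded away from zero. -/
theorem IsRun.exists_gap_le (hn : 0 < n) (hA : IsStable A) (hσ : σ ∈ Set.Ioo (0 : ℝ) 1)
    (hρ : ρ ∈ Set.Ioo (0 : ℝ) 1) (hα : 0 < α) (h : IsRun A σ ρ α 0 p a) {q : Vec n}
    (hq : q ∈ feasible A) :
    ∃ C : ℝ, 0 ≤ C ∧ ∀ k, ¬ Stopped 0 p k →
      objective A (p k) - objective A q ≤ C * ‖p k - p (k + 1)‖ := by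
  have h₀ := (uniform_mem_feasible hn hA).1
  obtain ⟨b, hb, htest⟩ := exists_forall_armijoTest hA hσ.2 h₀
  obtain ⟨G, hG⟩ := exists_norm_gradient_le hA h₀
  have hmin : 0 < min α (ρ * b) := lt_min hα (mul_pos hρ.1 hb)
  have hG0 : 0 ≤ G := (norm_nonneg _).trans (hG _ (h.mem_sublevel hn hA hσ.1 hρ hα 0))
  refine ⟨G + 2 / min α (ρ * b), by positivity, fun k hs => ?_⟩
  have hk := h.mem_sublevel hn hA hσ.1 hρ hα k
  have ha := h.armijo k hs
  have h1 := objective_sub_le_norm_trial_sub hA hk.2 hq (ha.pos hρ hα)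
  have h2 : p (k + 1) = trial A (p k) (a k) := h.step k hs
  rw [← h2, norm_sub_rev] at h1
  refine h1.trans (mul_le_mul_of_nonneg_right (add_le_add (hG _ hk) ?_) (norm_nonneg _))
  exact div_le_div_of_nonneg_left zero_le_two hmin (ha.min_le hρ hα (htest _ hk))

/-- A step of length zero makes the bound of `IsRun.exists_gap_le` vanish, so the method can only
stop at the minimizer. -/
theorem IsRun.eq_of_stopped (hn : 0 < n) (hA : IsStable A) (hσ : σ ∈ Set.Ioo (0 : ℝ) 1)
    (hρ : ρ ∈ Set.Ioo (0 : ℝ) 1) (hα : 0 < α) (h : IsRun A σ ρ α 0 p a) {q : Vec n}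
    (hq : IsVCS A q) {k : ℕ} (hs : Stopped 0 p k) : p k = q := by
  induction k with
  | zero => obtain ⟨j, hj, -⟩ := hs; omega
  | succ k ih =>
    by_cases hk : Stopped 0 p k
    · rw [h.hold k hk, ih hk]
    · obtain ⟨j, hj, hj0⟩ := hs
      obtain rfl : j = k := by
        by_contra hne
        exact hk ⟨j, by omega, hj0⟩
      obtain ⟨C, hC, hgap⟩ := h.exists_gap_le hn hA hσ hρ hα hq.1
      have h1 := hgap j hk
      have h2 : ‖p j - p (j + 1)‖ = 0 := le_antisymm hj0 (norm_nonneg _)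
      rw [h2, mul_zero] at h1
      have hpj := (h.mem_sublevel hn hA hσ.1 hρ hα j).2
      have hmin : IsMinOn (objective A) (feasible A) (p j) := fun r hr => by
        have h3 : objective A q ≤ objective A r := hq.2 hr
        change objective A (p j) ≤ objective A r
        linarith
      rw [← sub_eq_zero.mp (norm_eq_zero.mp h2)]
      exact (strictConvexOn_objective_feasible hA).eq_of_isMinOn hmin hq.2 hpj hq.1

/-- The gaps `δₖ = f(pₖ) - f(q)` satisfy `δₖ² ≤ C (δₖ - δₖ₊₁)`; being antitone and bounded below
they converge, and the limit can only be zero. -/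
theorem IsRun.tendsto_objective (hn : 0 < n) (hA : IsStable A) (hσ : σ ∈ Set.Ioo (0 : ℝ) 1)
    (hρ : ρ ∈ Set.Ioo (0 : ℝ) 1) (hα : 0 < α) (h : IsRun A σ ρ α 0 p a) {q : Vec n}
    (hq : IsVCS A q) : Tendsto (fun k => objective A (p k)) atTop (𝓝 (objective A q)) := by
  obtain ⟨C, hC, hgap⟩ := h.exists_gap_le hn hA hσ hρ hα hq.1
  set δ : ℕ → ℝ := fun k => objective A (p k) - objective A q
  have hmem := h.mem_sublevel hn hA hσ.1 hρ hα
  have hδ0 : ∀ k, 0 ≤ δ k := fun k => sub_nonneg.mpr (hq.2 (hmem k).2)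
  have hdesc : ∀ k, σ / α * ‖p k - p (k + 1)‖ ^ 2 ≤ δ k - δ (k + 1) := by
    intro k
    by_cases hs : Stopped 0 p k
    · simp [δ, h.hold k hs]
    · have ha := h.armijo k hs
      have h1 := ha.armijoTest.objective_trial_le hσ.1.le (ha.pos hρ hα) (hmem k).2.2
      have h2 : p (k + 1) = trial A (p k) (a k) := h.step k hs
      rw [← h2, norm_sub_rev] at h1
      have h3 : σ / α * ‖p k - p (k + 1)‖ ^ 2 ≤ σ / a k * ‖p k - p (k + 1)‖ ^ 2 :=
        mul_le_mul_of_nonneg_right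
          (div_le_div_of_nonneg_left hσ.1.le (ha.pos hρ hα) (ha.le hρ hα)) (sq_nonneg _)
      simp only [δ]
      linarith
  have hσα : 0 < σ / α := div_pos hσ.1 hα
  have hanti : Antitone δ := antitone_nat_of_succ_le fun k => by
    have h1 := hdesc k
    have h2 : 0 ≤ σ / α * ‖p k - p (k + 1)‖ ^ 2 := by positivity
    linarith
  have hsq : ∀ k, δ k ^ 2 ≤ C ^ 2 / (σ / α) * (δ k - δ (k + 1)) := by
    intro k
    by_cases hs : Stopped 0 p k
    · simp [δ, h.hold k hs, h.eq_of_stopped hn hA hσ hρ hα hq hs]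
    · have hσ0 := hσ.1.ne'
      calc δ k ^ 2 ≤ (C * ‖p k - p (k + 1)‖) ^ 2 := pow_le_pow_left₀ (hδ0 k) (hgap k hs) 2
        _ = C ^ 2 / (σ / α) * (σ / α * ‖p k - p (k + 1)‖ ^ 2) := by field_simp
        _ ≤ _ := mul_le_mul_of_nonneg_left (hdesc k) (by positivity)
  have hlim := tendsto_atTop_ciInf hanti ⟨0, by rintro _ ⟨k, rfl⟩; exact hδ0 k⟩
  have hlim' := hlim.comp (tendsto_add_atTop_nat 1)
  have h0 : (⨅ k, δ k) ^ 2 ≤ C ^ 2 / (σ / α) * ((⨅ k, δ k) - ⨅ k, δ k) :=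
    le_of_tendsto_of_tendsto' (hlim.pow 2) ((hlim.sub hlim').const_mul _) hsq
  rw [sub_self, mul_zero] at h0
  rw [pow_eq_zero_iff two_ne_zero |>.mp (le_antisymm h0 (sq_nonneg _))] at hlim
  simpa [δ] using hlim.add_const (objective A q)

theorem IsRun.tendsto_vcs (hn : 0 < n) (hA : IsStable A) (hσ : σ ∈ Set.Ioo (0 : ℝ) 1)
    (hρ : ρ ∈ Set.Ioo (0 : ℝ) 1) (hα : 0 < α) (h : IsRun A σ ρ α 0 p a) {q : Vec n}
    (hq : IsVCS A q) : Tendsto p atTop (𝓝 q) := by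
  have h₀ := (uniform_mem_feasible hn hA).1
  refine (isCompact_sublevel hA h₀).tendsto_nhds_of_unique_mapClusterPt
    (Eventually.of_forall (h.mem_sublevel hn hA hσ.1 hρ hα)) fun x hx hcl => ?_
  have hc : ContinuousAt (objective A) x := (contDiffAt_objective hx.2.1 (k := 0)).continuousAt
  have h1 : MapClusterPt (objective A x) atTop (objective A ∘ p) := hcl.continuousAt_comp hc
  have h2 : objective A x = objective A q :=
    have : (𝓝 (objective A x) ⊓ 𝓝 (objective A q)).NeBot :=
      ClusterPt.mono h1 (h.tendsto_objective hn hA hσ hρ hα hq)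
    eq_of_nhds_neBot this
  have hmin : IsMinOn (objective A) (feasible A) x := fun r hr => by
    change objective A x ≤ objective A r
    exact h2.trans_le (hq.2 hr)
  exact (strictConvexOn_objective_feasible hA).eq_of_isMinOn hmin hq.2 hx.2 hq.1

end Run

end ControllabilityScore

theorem theorem6 {n : ℕ} (hn : 0 < n) (A : Matrix (Fin n) (Fin n) ℝ) (hA : IsStable A)
    {σ ρ α : ℝ} (hσ : σ ∈ Set.Ioo (0 : ℝ) 1) (hρ : ρ ∈ Set.Ioo (0 : ℝ) 1) (hα : 0 < α) :
    -- the feasible starting point and the compact convex problem on its sublevel set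
    uniform n ∈ feasible A ∧
    IsCompact (sublevel A (uniform n)) ∧
    ConvexOn ℝ (sublevel A (uniform n)) (objective A) ∧
    -- the method is well defined: every backtracking loop ends
    (∃ (p : ℕ → Vec n) (a : ℕ → ℝ), IsRun A σ ρ α 0 p a) ∧
    ∃ pstar : Vec n,
      -- `pstar` is the unique VCS, and also the unique solution of the problem on the sublevel set
      (∀ q : Vec n, IsVCS A q ↔ q = pstar) ∧
      (∀ q : Vec n, IsSolution (objective A) (sublevel A (uniform n)) q ↔ q = pstar) ∧
      ∀ (p : ℕ → Vec n) (a : ℕ → ℝ), IsRun A σ ρ α 0 p a →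
        Tendsto p atTop (𝓝 pstar) ∧
        (∀ k, ‖p k - p (k + 1)‖ ≤ 0 → p (k + 1) = pstar) ∧
        (∀ k, p k ∈ sublevel A (uniform n)) ∧
        -- each step is a projected gradient step for the problem on the sublevel set
        (∀ k, ¬ Stopped 0 p k →
          p (k + 1) =
            proj (sublevel A (uniform n)) (p k - a k • gradient (objective A) (p k))) := by
  have h₀ := uniform_mem_feasible hn hA
  obtain ⟨pstar, hstar⟩ := exists_isVCS_iff_eq hA h₀
  have hV : IsVCS A pstar := (hstar pstar).mpr rfl
  refine ⟨h₀, isCompact_sublevel hA h₀.1, convexOn_objective_sublevel hA _,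
    exists_isRun hn hA hσ hρ hα, pstar, hstar,
    fun q => (isVCS_iff_isSolution_sublevel h₀ q).symm.trans (hstar q), fun p a hrun =>
    ⟨hrun.tendsto_vcs hn hA hσ hρ hα hV, fun k hk => ?_, hrun.mem_sublevel hn hA hσ.1 hρ hα,
      fun k hk => hrun.step_eq_proj_sublevel hn hA hσ.1 hρ hα hk⟩⟩
  exact hrun.eq_of_stopped hn hA hσ hρ hα hV ⟨k, Nat.lt_succ_self k, hk⟩
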